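/- Proposition 1.1. Conventions. Fréchet spaces are real. A map $g\colon U\to F$ on an open subset $U$ of a Fréchet space $E$ into a Fréchet space $F$ is $C^1$ if it is continuous, the directional derivatives $dg(x,y)=\frac{d}{dt}\big|_{t=0}g(x+ty)$ exist for all $(x,y)\in U\times E$, and $dg\colon U\times E\to F$ is continuous. $C^1$-manifolds modelled on Fréchet spaces, their tangent spaces and $C^1$-maps between them are defined through charts as usual (manifolds need not be Hausdorff). A function $\gamma\colon[a,b]\to E$ is $\mathcal L^1$ if it is Borel measurable, has separable image, and $\int_a^b q(\gamma(t))\,dt<\infty$ for each continuous seminorm $q$ on $E$. A function $\eta\colon[a,b]\to E$ is absolutely continuous if there is an $\mathcal L^1$-function $\gamma$ with $\eta(t)=\eta(a)+\int_a^t\gamma(s)\,ds$ (weak integral) for all $t\in[a,b]$. A function $\eta\colon I\to M$ from a non-degenerate interval $I$ to a $C^1$-manifold modelled on a Fréchet space is absolutely continuous if it is continuous and each $t_0\in I$ is in the interior relative to $I$ of some $[\alpha,\beta]\subseteq I$, $\alpha<\beta$, such that $\eta([\alpha,\beta])$ lies in the domain of a chart $\phi$ for which $\phi\circ\eta|_{[\alpha,\beta]}$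 is absolutely continuous. Write $\dot\eta(t)\in T_{\eta(t)}M$ for the velocity vector (computed in a chart) where it exists, and $\lambda$ for Lebesgue measure. Let $M$ be a $C^1$-manifold modelled on a Fréchet space, $J\subseteq\mathbb R$ a non-degenerate interval, $W\subseteq J\times M$ a relatively open subset, and $f\colon W\to TM$ a map with $f(t,y)\in T_yM$ for all $(t,y)\in W$. A Carathéodory solution to $$\dot y(t)=f(t,y(t))\qquad(*)$$ is an absolutely continuous function $\gamma\colon I\to M$ on a non-degenerate interval $I\subseteq\mathbb R$ such that $(t,\gamma(t))\in W$ for all $t\in I$ and, for almost all $t\in I$, $\dot\gamma(t)$ exists and equals $f(t,\gamma(t))$; it solves the initial value problem with $y(t_0)=y_0$ if moreover $t_0\in I$ and $\gamma(t_0)=y_0$. Assume that $(*)$ admits local flows which are pullbacks of $C^1$-maps, i.e., for each $(\bar t,\bar y)\in W$ there are a relatively open interval $I\subseteq J$ with $\bar t\in I$, an open neighbourhood $V$ of $\bar y$ in $M$ with $I\times V\subseteq W$, and a function $\Phi\colon I\times I\times V\to M$, $\Phi_{t,t_0}(y_0):=\Phi(t,t_0,y_0)$, such that: (a) for all $(t_0,y_0)\in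 I\times V$, the function $I\to M$, $t\mapsto\Phi_{t,t_0}(y_0)$ is a Carathéodory solution to $(*)$ with $y(t_0)=y_0$; (b) there is an open neighbourhood $Y\subseteq V$ of $\bar y$ such that $\Phi_{t_1,t_0}(Y)\subseteq V$ and $\Phi_{t_2,t_1}(\Phi_{t_1,t_0}(y_0))=\Phi_{t_2,t_0}(y_0)$ for all $t_0,t_1,t_2\in I$ and $y_0\in Y$; (c) there are $C^1$-manifolds $N_1,N_2$ modelled on Fréchet spaces, absolutely continuous functions $\zeta_j\colon I\to N_j$ for $j\in\{1,2\}$, and a $C^1$-map $\Psi\colon N_1\times N_2\times V\to M$ such that $\Phi(t,t_0,y_0)=\Psi(\zeta_1(t),\zeta_2(t_0),y_0)$ for all $(t,t_0,y_0)\in I\times I\times V$; moreover, there is a Borel set $I_0\subseteq I$ with $\lambda(I\setminus I_0)=0$ such that $\frac{d}{dt}\Phi_{t,t_0}(y_0)$ exists and equals $f(t,\Phi_{t,t_0}(y_0))$ for all $y_0\in V$, $t_0\in I$ and $t\in I_0$. Then $(*)$ satisfies local existence of Carathéodory solutions: for each $(t_0,y_0)\in W$ there is a Carathéodory solution $\gamma\colon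 I\to M$ to $(*)$ with $y(t_0)=y_0$ on a relatively open subinterval $I$ of $J$. And $(*)$ satisfies local uniqueness of Carathéodory solutions: if $\gamma_1\colon I_1\to M$ and $\gamma_2\colon I_2\to M$ are Carathéodory solutions to $(*)$ and $t_0\in I_1\cap I_2$ with $\gamma_1(t_0)=\gamma_2(t_0)$, then there is an interval $K$ which is a relatively open neighbourhood of $t_0$ in $I_1\cap I_2$ such that $\gamma_1|_K=\gamma_2|_K$. -/

import Mathlib

open Set Filter Topology MeasureTheory

universe v u w

namespace CaratheodoryFlow

/-- A (real) Fréchet space: a complete, Hausdorff, locally convex topological vector space whose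
topology is metrizable. The uniformity of such a space is the one determined by the topological
group structure (`IsUniformAddGroup`), and a Hausdorff uniform space is metrizable if and only if
its uniformity is countably generated. -/
class FrechetSpace (E : Type*) [AddCommGroup E] [Module ℝ E] [UniformSpace E] : Prop where
  isUniformAddGroup : IsUniformAddGroup E
  continuousSMul : ContinuousSMul ℝ E
  locallyConvexSpace : LocallyConvexSpace ℝ E
  completeSpace : CompleteSpace E
  t2Space : T2Space E
  isCountablyGenerated : (uniformity E).IsCountablyGenerated

/-- `S` is a relatively open subset of `A`. -/
def IsRelOpen {X : Type*} [TopologicalSpace X] (S A : Set X) : Prop :=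
  ∃ O : Set X, IsOpen O ∧ S = O ∩ A

/-- `I` is a non-degenerate interval in the real line (of any type, possibly unbounded). -/
def IsNondegInterval (I : Set ℝ) : Prop :=
  I.OrdConnected ∧ I.Nontrivial

section Calculus

variable {E F : Type*} [AddCommGroup E] [Module ℝ E] [TopologicalSpace E]
  [AddCommGroup F] [Module ℝ F] [TopologicalSpace F]

/-- The directional derivative `d/dt|_{t=0} g (x + t y)` exists and equals `w`. -/
def HasDirDeriv (g : E → F) (x y : E) (w : F) : Prop :=
  Tendsto (fun t : ℝ => t⁻¹ • (g (x + t • y) - g x)) (𝓝[≠] 0) (𝓝 w)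

/-- `C¹`-maps on an open subset `U` of a locally convex space, in the sense of Keller's
`C¹_c`-theory (Michal, Bastiani): `g` is continuous on `U`, all directional derivatives
`dg (x, y)`, `x ∈ U`, `y ∈ E`, exist, and `dg : U × E → F` is continuous. -/
def IsC1On (g : E → F) (U : Set E) : Prop :=
  ContinuousOn g U ∧
    ∃ dg : E × E → F, ContinuousOn dg (U ×ˢ univ) ∧
      ∀ x ∈ U, ∀ y : E, HasDirDeriv g x y (dg (x, y))

/-- The derivative at `t₀ ∈ I` of a curve `η` defined on `I`, as a limit of difference quotients
`(t - t₀)⁻¹ • (η t - η t₀)` with `t ∈ I`, `t ≠ t₀`. -/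
def HasCurveDeriv (η : ℝ → E) (I : Set ℝ) (t₀ : ℝ) (v : E) : Prop :=
  Tendsto (slope η t₀) (𝓝[I \ {t₀}] t₀) (𝓝 v)

/-- `γ ∈ 𝓛¹([a,b], E)`: Borel measurable, with separable image, and
`∫_{[a,b]} q (γ t) dt < ∞` for each continuous seminorm `q`.
Only the values of `γ` on `[a,b]` matter. -/
structure IsL1 (γ : ℝ → E) (a b : ℝ) : Prop where
  measurable : @Measurable (Icc a b) E _ (borel E) (fun t => γ t)
  separable : TopologicalSpace.IsSeparable (γ '' Icc a b)
  integrable : ∀ q : Seminorm ℝ E, Continuous q →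
    ∫⁻ t in Icc a b, ENNReal.ofReal (q (γ t)) < ⊤

/-- `x` is the weak integral `∫_a^t γ(s) ds`. -/
def IsWeakIntegral (γ : ℝ → E) (a t : ℝ) (x : E) : Prop :=
  ∀ l : E →L[ℝ] ℝ, l x = ∫ s in a..t, l (γ s)

/-- `η : [a,b] → E` is absolutely continuous: it is the primitive, in the sense of weak
integrals, of an `𝓛¹`-function. -/
def IsACOnIcc (η : ℝ → E) (a b : ℝ) : Prop :=
  ∃ γ : ℝ → E, IsL1 γ a b ∧ ∀ t ∈ Icc a b, IsWeakIntegral γ a t (η t - η a)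

end Calculus

section Manifolds

variable {E : Type*} [AddCommGroup E] [Module ℝ E] [TopologicalSpace E]
  {M : Type*} [TopologicalSpace M] [ChartedSpace E M]

/-- The charts of the given atlas of `M` around the point `x`. -/
abbrev ChartsAt (E : Type*) [TopologicalSpace E] {M : Type*} [TopologicalSpace M]
    [ChartedSpace E M] (x : M) : Type _ :=
  {e : OpenPartialHomeomorph M E // e ∈ atlas E M ∧ x ∈ e.source}

/-- `M`, with its atlas of charts with values in `E`, is a `C¹`-manifold modelled on `E`: all
changes of charts are `C¹`. (Being Hausdorff is not required.) -/
class IsC1Manifold (E : Type*) [AddCommGroup E] [Module ℝ E] [TopologicalSpace E]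
    (M : Type*) [TopologicalSpace M] [ChartedSpace E M] : Prop where
  compatible : ∀ e ∈ atlas E M, ∀ e' ∈ atlas E M,
    IsC1On (e' ∘ e.symm) (e.symm.trans e').source

/-- `g` is a `C¹`-map on the open subset `S` of the manifold `X`, with values in the manifold `Y`:
it is continuous there and `C¹` in charts. -/
def IsC1MapOn {G X F Y : Type*} [AddCommGroup G] [Module ℝ G] [TopologicalSpace G]
    [TopologicalSpace X] (chartsX : ChartedSpace G X)
    [AddCommGroup F] [Module ℝ F] [TopologicalSpace F]
    [TopologicalSpace Y] (chartsY : ChartedSpace F Y) (g : X → Y) (S : Set X) : Prop :=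
  ContinuousOn g S ∧
    ∀ e ∈ chartsX.atlas, ∀ e' ∈ chartsY.atlas,
      IsC1On (e' ∘ g ∘ e.symm) (e.target ∩ e.symm ⁻¹' (S ∩ g ⁻¹' e'.source))

/-- The product manifold `M × N` modelled on `E × F`, with the products of charts as its charts. -/
@[reducible]
def prodCharts {E M F N : Type*} [TopologicalSpace E] [TopologicalSpace M]
    [TopologicalSpace F] [TopologicalSpace N]
    (chartsM : ChartedSpace E M) (chartsN : ChartedSpace F N) : ChartedSpace (E × F) (M × N) :=
  prodChartedSpace E M F N

/-- The tangent space `T_x M`: a tangent vector is given by its representative in each chart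
around `x`, where the representatives are transformed into each other by the derivatives of the
changes of charts. The representative `coord φ` is `dφ(v) ∈ E`. -/
@[ext]
structure TangentVector (E : Type*) [AddCommGroup E] [Module ℝ E] [TopologicalSpace E]
    {M : Type*} [TopologicalSpace M] [ChartedSpace E M] (x : M) where
  coord : ChartsAt E x → E
  compatible : ∀ e e' : ChartsAt E x,
    HasDirDeriv (e'.1 ∘ e.1.symm) (e.1 x) (coord e) (coord e')

/-- The curve `η : I → M` is differentiable at `t₀ ∈ I` with velocity `v ∈ T_{η(t₀)} M`: for some
chart `φ` around `η t₀`, the curve `φ ∘ η` (which is defined on a neighbourhood of `t₀` in `I` as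
`η` is continuous) has derivative `dφ(v)` at `t₀`. -/
def HasVelocityAt (η : ℝ → M) (I : Set ℝ) (t₀ : ℝ) (v : TangentVector E (η t₀)) : Prop :=
  ∃ e : ChartsAt E (η t₀), HasCurveDeriv (e.1 ∘ η) (I ∩ η ⁻¹' e.1.source) t₀ (v.coord e)

variable (E) in
/-- The curve `η : I → M` is absolutely continuous: it is continuous and each `t₀ ∈ I` lies in the
interior relative to `I` of an interval `[α, β] ⊆ I` which `η` takes to the domain of a chart in
which `η|_[α, β]` is absolutely continuous. Only the values of `η` on `I` matter. -/
def IsACCurve (η : ℝ → M) (I : Set ℝ) : Prop :=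
  ContinuousOn η I ∧
    ∀ t₀ ∈ I, ∃ e ∈ atlas E M, ∃ α β : ℝ, α < β ∧ Icc α β ⊆ I ∧ Icc α β ∈ 𝓝[I] t₀ ∧
      MapsTo η (Icc α β) e.source ∧ IsACOnIcc (e ∘ η) α β

end Manifolds

section Equation

variable {E : Type*} [AddCommGroup E] [Module ℝ E] [TopologicalSpace E]
  {M : Type*} [TopologicalSpace M] [ChartedSpace E M] {W : Set (ℝ × M)}

/-- `γ : I → M` is a Carathéodory solution to `ẏ(t) = f(t, y(t))`. -/
structure IsCaratheodorySolution (f : (p : W) → TangentVector E p.1.2) (I : Set ℝ) (γ : ℝ → M) :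
    Prop where
  interval : IsNondegInterval I
  absCont : IsACCurve E γ I
  mem : ∀ t ∈ I, (t, γ t) ∈ W
  velocity : ∀ᵐ t ∂(volume.restrict I),
    ∃ h : (t, γ t) ∈ W, HasVelocityAt γ I t (f ⟨(t, γ t), h⟩)

/-- `γ : I → M` is a Carathéodory solution to `ẏ(t) = f(t, y(t))`, `y(t₀) = y₀`. -/
def IsIVPSolution (f : (p : W) → TangentVector E p.1.2) (t₀ : ℝ) (y₀ : M) (I : Set ℝ)
    (γ : ℝ → M) : Prop :=
  IsCaratheodorySolution f I γ ∧ t₀ ∈ I ∧ γ t₀ = y₀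

/-- `ẏ(t) = f(t, y(t))` satisfies local uniqueness of Carathéodory solutions. -/
def LocalUniqueness (f : (p : W) → TangentVector E p.1.2) : Prop :=
  ∀ (I₁ I₂ : Set ℝ) (γ₁ γ₂ : ℝ → M),
    IsCaratheodorySolution f I₁ γ₁ → IsCaratheodorySolution f I₂ γ₂ →
    ∀ t₀ ∈ I₁ ∩ I₂, γ₁ t₀ = γ₂ t₀ →
      ∃ K : Set ℝ, K.OrdConnected ∧ IsRelOpen K (I₁ ∩ I₂) ∧ t₀ ∈ K ∧ EqOn γ₁ γ₂ K

/-- `ẏ(t) = f(t, y(t))` satisfies local existence of Carathéodory solutions (relative to `J`). -/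
def LocalExistence (J : Set ℝ) (f : (p : W) → TangentVector E p.1.2) : Prop :=
  ∀ (t₀ : ℝ) (y₀ : M), (t₀, y₀) ∈ W →
    ∃ (I : Set ℝ) (γ : ℝ → M), IsRelOpen I J ∧ IsIVPSolution f t₀ y₀ I γ

end Equation

section Flows

variable {E : Type u} [AddCommGroup E] [Module ℝ E] [TopologicalSpace E]
  {M : Type w} [TopologicalSpace M] [chartsM : ChartedSpace E M] {W : Set (ℝ × M)}

variable (E) in
/-- `Φ : I × I × V → M` is a pullback of a `C¹`-map along absolutely continuous curves: there are
`C¹`-manifolds `N₁`, `N₂` modelled on Fréchet spaces, absolutely continuous curves `ζⱼ : I → Nⱼ`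
and a `C¹`-map `Ψ : N₁ × N₂ × V → M` such that `Φ(t, t₀, y₀) = Ψ(ζ₁(t), ζ₂(t₀), y₀)`. -/
def IsPullbackOfC1Map (I : Set ℝ) (V : Set M) (Φ : ℝ → ℝ → M → M) : Prop :=
  ∃ (E₁ : Type v) (_ : AddCommGroup E₁) (_ : Module ℝ E₁) (_ : UniformSpace E₁)
    (_ : FrechetSpace E₁)
    (E₂ : Type v) (_ : AddCommGroup E₂) (_ : Module ℝ E₂) (_ : UniformSpace E₂)
    (_ : FrechetSpace E₂)
    (N₁ : Type v) (_ : TopologicalSpace N₁) (charts₁ : ChartedSpace E₁ N₁)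
    (_ : IsC1Manifold E₁ N₁)
    (N₂ : Type v) (_ : TopologicalSpace N₂) (charts₂ : ChartedSpace E₂ N₂)
    (_ : IsC1Manifold E₂ N₂)
    (ζ₁ : ℝ → N₁) (ζ₂ : ℝ → N₂) (Ψ : N₁ × N₂ × M → M),
    IsACCurve E₁ ζ₁ I ∧ IsACCurve E₂ ζ₂ I ∧
    IsC1MapOn (prodCharts charts₁ (prodCharts charts₂ chartsM)) chartsM Ψ
      (univ ×ˢ univ ×ˢ V) ∧
    ∀ t ∈ I, ∀ t₀ ∈ I, ∀ y₀ ∈ V, Φ t t₀ y₀ = Ψ (ζ₁ t, ζ₂ t₀, y₀)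

/-- `ẏ(t) = f(t, y(t))` admits local flows which are pullbacks of `C¹`-maps. -/
def AdmitsLocalFlows (J : Set ℝ) (f : (p : W) → TangentVector E p.1.2) : Prop :=
  ∀ (tbar : ℝ) (ybar : M), (tbar, ybar) ∈ W →
    ∃ (I : Set ℝ) (V : Set M) (Φ : ℝ → ℝ → M → M),
      I.OrdConnected ∧ IsRelOpen I J ∧ tbar ∈ I ∧ IsOpen V ∧ ybar ∈ V ∧ I ×ˢ V ⊆ W ∧
      (∀ t₀ ∈ I, ∀ y₀ ∈ V, IsIVPSolution f t₀ y₀ I (fun t => Φ t t₀ y₀)) ∧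
      (∃ Y : Set M, IsOpen Y ∧ ybar ∈ Y ∧ Y ⊆ V ∧
        (∀ t₀ ∈ I, ∀ t₁ ∈ I, MapsTo (Φ t₁ t₀) Y V) ∧
        ∀ t₀ ∈ I, ∀ t₁ ∈ I, ∀ t₂ ∈ I, ∀ y₀ ∈ Y, Φ t₂ t₁ (Φ t₁ t₀ y₀) = Φ t₂ t₀ y₀) ∧
      IsPullbackOfC1Map.{v} E I V Φ ∧
      (∃ I₀ : Set ℝ, MeasurableSet I₀ ∧ I₀ ⊆ I ∧ volume (I \ I₀) = 0 ∧
        ∀ y₀ ∈ V, ∀ t₀ ∈ I, ∀ t ∈ I₀, ∃ h : (t, Φ t t₀ y₀) ∈ W,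
          HasVelocityAt (fun s => Φ s t₀ y₀) I t (f ⟨(t, Φ t t₀ y₀), h⟩))

end Flows

end CaratheodoryFlow

/-! Existence is built into the flows: `t ↦ Φ t t₀ y₀` is a solution. For uniqueness, a solution `γ`
is transported back to time `t₀`: near `t₀` the curve `t ↦ Φ t₀ t (γ t) = Ψ (ζ₁ t₀, ζ₂ t, γ t)` is
shown to be constant, hence equal to `γ t₀`; applying `Φ t t₀` gives `γ t = Φ t t₀ (γ t₀)`, which
depends only on the initial value.

Constancy is proved for the real functions `u` obtained by reading this curve in a chart and
applying a continuous linear functional. A `C¹`-map composed with a functional is locally Lipschitz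
for a continuous seminorm (`IsC1On.exists_seminorm_lipschitz`), so increments of `u` are dominated
by those of an indefinite integral and `u` is locally absolutely continuous. For almost every `t`,
`γ` and `δ s = Φ s t (γ t)` have the same velocity at `t`, while `Φ t₀ s (δ s) = Φ t₀ t (γ t)` does
not depend on `s`. The Lipschitz estimate bounds `u s - u t` by a seminorm of `γ s - δ s` in a
chart, which is `o(s - t)`; so `u' = 0` almost everywhere. The argument is
`IsCaratheodorySolution.eventually_flow_eq`. -/

namespace CaratheodoryFlow

/-! ### Constancy of real functions with almost everywhere vanishing derivative -/

section Real

/-- A real function on an interval is constant if its increments are locally dominated by the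
increments of an indefinite Lebesgue integral and its derivative vanishes almost everywhere. -/
theorem eq_of_increments_le_integral_of_ae_slope_tendsto_zero {K : Set ℝ} (hK : K.OrdConnected)
    {u : ℝ → ℝ} (hder : ∀ᵐ t ∂volume.restrict K, Tendsto (slope u t) (𝓝[K \ {t}] t) (𝓝 0))
    (hloc : ∀ t₁ ∈ K, ∃ k : ℝ → ℝ, IntegrableOn k K ∧ ∃ N ∈ 𝓝[K] t₁, ∀ s ∈ N, ∀ s' ∈ N, s ≤ s' →
      |u s' - u s| ≤ ∫ r in s..s', k r) {s s' : ℝ} (hs : s ∈ K) (hs' : s' ∈ K) : u s = u s' := by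
  have hder' : ∀ᵐ t, t ∈ K → Tendsto (slope u t) (𝓝[K \ {t}] t) (𝓝 0) :=
    ae_imp_of_ae_restrict hder
  have key : ∀ t₁ ∈ K, ∀ᶠ t in 𝓝[K] t₁, u t₁ = u t := by
    intro t₁ ht₁
    obtain ⟨k, hk, N, hN, hu⟩ := hloc t₁ ht₁
    obtain ⟨ε, hε, hεN⟩ := Metric.mem_nhdsWithin_iff.1 hN
    have main : ∀ a ∈ Metric.ball t₁ ε ∩ K, ∀ b ∈ Metric.ball t₁ ε ∩ K, a < b → u a = u b := by
      intro a ha b hb hab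
      have hoc : (Metric.ball t₁ ε ∩ K).OrdConnected :=
        (convex_ball t₁ ε).ordConnected.inter hK
      have hsub : Icc a b ⊆ Metric.ball t₁ ε ∩ K := hoc.out ha hb
      have hint : IntervalIntegrable k volume a b := by
        rw [intervalIntegrable_iff_integrableOn_Icc_of_le hab.le]
        exact hk.mono_set fun x hx => (hsub hx).2
      have hv := hint.absolutelyContinuousOnInterval_intervalIntegral (c := a) left_mem_uIcc
      have hii : ∀ x ∈ Icc a b, ∀ y ∈ Icc a b, IntervalIntegrable k volume x y := by
        intro x hx y hy
        refine hint.mono_set ?_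
        rw [uIcc_of_le hab.le]
        exact ordConnected_Icc.uIcc_subset hx hy
      have hdist : ∀ x ∈ Icc a b, ∀ y ∈ Icc a b,
          dist (u x) (u y) ≤ dist (∫ r in a..x, k r) (∫ r in a..y, k r) := by
        have aux : ∀ x ∈ Icc a b, ∀ y ∈ Icc a b, x ≤ y →
            dist (u x) (u y) ≤ dist (∫ r in a..x, k r) (∫ r in a..y, k r) := by
          intro x hx y hy hxy
          rw [dist_comm, Real.dist_eq, dist_comm, Real.dist_eq,
            intervalIntegral.integral_interval_sub_left (hii a (left_mem_Icc.2 hab.le) y hy)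
              (hii a (left_mem_Icc.2 hab.le) x hx)]
          exact (hu x (hεN (hsub hx)) y (hεN (hsub hy)) hxy).trans (le_abs_self _)
        intro x hx y hy
        rcases le_total x y with h | h
        · exact aux x hx y hy h
        · rw [dist_comm, dist_comm (∫ r in a..x, k r)]
          exact aux y hy x hx h
      -- Absolute continuity passes from the indefinite integral to `u` by comparing the sums of
      -- increments termwise.
      have hac : AbsolutelyContinuousOnInterval u a b := by
        refine squeeze_zero' (Eventually.of_forall fun E => Finset.sum_nonneg fun _ _ =>
          dist_nonneg) ?_ hv
        refine eventually_inf_principal.2 (Eventually.of_forall fun E hE =>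
          Finset.sum_le_sum fun i hi => ?_)
        have := hE.1 i hi
        rw [uIcc_of_le hab.le] at this
        exact hdist _ this.1 _ this.2
      have h0 : ∀ᵐ x, x ∈ uIcc a b → HasDerivAt u 0 x := by
        -- Dropping the endpoints makes `K` a full neighbourhood of `x`, so the limit within `K` is
        -- a two-sided derivative.
        filter_upwards [hder', Measure.ae_ne volume a, Measure.ae_ne volume b]
          with x hx hxa hxb hxab
        rw [uIcc_of_le hab.le] at hxab
        rw [hasDerivAt_iff_tendsto_slope]
        refine (hx (hsub hxab).2).mono_left ?_
        have hnhds : K ∈ 𝓝 x := mem_of_superset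
          (Icc_mem_nhds (lt_of_le_of_ne hxab.1 (Ne.symm hxa)) (lt_of_le_of_ne hxab.2 hxb))
          fun y hy => (hsub hy).2
        rw [sdiff_eq, nhdsWithin_inter_of_mem (mem_nhdsWithin_of_mem_nhds hnhds)]
      obtain ⟨C, hC⟩ := hac.const_of_ae_hasDerivAt_zero h0
      rw [hC a left_mem_uIcc, hC b right_mem_uIcc]
    filter_upwards [inter_mem_nhdsWithin K (Metric.ball_mem_nhds t₁ hε)] with t ht
    have ht₁' : t₁ ∈ Metric.ball t₁ ε ∩ K := ⟨Metric.mem_ball_self hε, ht₁⟩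
    rcases lt_trichotomy t₁ t with h | h | h
    · exact main _ ht₁' _ ht.symm h
    · rw [h]
    · exact (main _ ht.symm _ ht₁' h).symm
  exact hK.isPreconnected.induction₂ (fun x y => u x = u y) key
    (fun _ _ _ _ _ _ h h' => h.trans h') (fun _ _ _ _ h => h.symm) hs hs'

end Real

/-! ### Differential calculus and absolutely continuous curves in locally convex spaces -/

section Calculus

variable {E F : Type*} [AddCommGroup E] [Module ℝ E]
  [AddCommGroup F] [Module ℝ F] [TopologicalSpace F]

theorem HasDirDeriv.smul [ContinuousConstSMul ℝ F] {g : E → F} {x y : E} {w : F}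
    (h : HasDirDeriv g x y w) (c : ℝ) : HasDirDeriv g x (c • y) (c • w) := by
  rcases eq_or_ne c 0 with rfl | hc
  · simpa [HasDirDeriv] using tendsto_const_nhds
  · have h1 : Tendsto (fun t : ℝ => t * c) (𝓝[≠] 0) (𝓝[≠] 0) := by
      refine tendsto_nhdsWithin_iff.2 ⟨?_, ?_⟩
      · have : Tendsto (fun t : ℝ => t * c) (𝓝 0) (𝓝 (0 * c)) :=
          (continuous_mul_const c).tendsto 0
        rw [zero_mul] at this
        exact this.mono_left nhdsWithin_le_nhds
      · filter_upwards [self_mem_nhdsWithin] with t ht using mul_ne_zero ht hc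
    refine ((Tendsto.comp h h1).const_smul c).congr fun t => ?_
    simp only [Function.comp_apply, smul_smul, mul_inv]
    congr 1
    field_simp

theorem HasDirDeriv.hasDerivAt_comp_clm {g : E → F} {x y : E} {r : ℝ} {w : F}
    (h : HasDirDeriv g (x + r • y) y w) (l : F →L[ℝ] ℝ) :
    HasDerivAt (fun r : ℝ => l (g (x + r • y))) (l w) r := by
  rw [hasDerivAt_iff_tendsto_slope_zero]
  refine ((l.continuous.tendsto w).comp h).congr fun t => ?_
  simp [add_smul, add_assoc]

/-- The scalar mean value theorem for `l ∘ g` along a segment; the intermediate point depends on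
`l`. -/
theorem exists_dirDeriv_eq_increment {g : E → F} {d : ℝ → F} {x y : E} (l : F →L[ℝ] ℝ)
    (h : ∀ r ∈ Icc (0 : ℝ) 1, HasDirDeriv g (x + r • y) y (d r)) :
    ∃ r ∈ Icc (0 : ℝ) 1, l (d r) = l (g (x + y)) - l (g x) := by
  have hd := fun r hr => (h r hr).hasDerivAt_comp_clm l
  obtain ⟨r, hr, h'⟩ := exists_hasDerivAt_eq_slope (fun r : ℝ => l (g (x + r • y)))
    (fun r => l (d r)) zero_lt_one
    (fun r hr => (hd r hr).continuousAt.continuousWithinAt)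
    (fun r hr => hd r (Ioo_subset_Icc_self hr))
  exact ⟨r, Ioo_subset_Icc_self hr, by simpa using h'⟩

variable [TopologicalSpace E]

theorem IsL1.aestronglyMeasurable_comp {γ : ℝ → E} {a b : ℝ} (h : IsL1 γ a b) {p : E → ℝ}
    (hp : Continuous p) : AEStronglyMeasurable (fun r => p (γ r)) (volume.restrict (Icc a b)) := by
  let : MeasurableSpace E := borel E
  have : BorelSpace E := ⟨rfl⟩
  have h1 : Measurable fun t : Icc a b => γ t := h.measurable
  exact (aemeasurable_restrict_of_measurable_subtype (f := fun r => p (γ r)) measurableSet_Icc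
    (hp.measurable.comp h1)).aestronglyMeasurable

theorem IsL1.integrableOn_seminorm {γ : ℝ → E} {a b : ℝ} (h : IsL1 γ a b) {q : Seminorm ℝ E}
    (hq : Continuous q) : IntegrableOn (fun r => q (γ r)) (Icc a b) := by
  refine ⟨h.aestronglyMeasurable_comp hq, ?_⟩
  refine lt_of_eq_of_lt (lintegral_congr fun r => ?_) (h.integrable q hq)
  exact Real.enorm_of_nonneg (apply_nonneg q _)

variable [IsTopologicalAddGroup E]

/-- Hahn–Banach: the functional `c • x ↦ c * q x` on the line through `x` is extended under the
bound `q`. Such a norming functional turns a seminorm of a weak integral into a scalar integral. -/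
theorem exists_clm_abs_le_seminorm {q : Seminorm ℝ E} (hq : Continuous q) (x : E) :
    ∃ l : E →L[ℝ] ℝ, (∀ y, |l y| ≤ q y) ∧ l x = q x := by
  rcases eq_or_ne x 0 with rfl | hx
  · exact ⟨0, by simp, by simp⟩
  obtain ⟨g, hgx, hg⟩ := exists_extension_of_le_sublinear
    (LinearPMap.mkSpanSingleton (K := ℝ) x (q x) hx) q
    (fun c hc y => by rw [map_smul_eq_mul, Real.norm_eq_abs, abs_of_pos hc])
    (fun y z => map_add_le_add q y z)
    (by
      rintro ⟨y, hy⟩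
      obtain ⟨c, rfl⟩ := Submodule.mem_span_singleton.1 hy
      rw [LinearPMap.mkSpanSingleton'_apply]
      rw [map_smul_eq_mul, Real.norm_eq_abs, smul_eq_mul]
      exact mul_le_mul_of_nonneg_right (le_abs_self c) (apply_nonneg q x))
  have habs : ∀ y, |g y| ≤ q y := fun y => abs_le.2 ⟨by
    have := hg (-y)
    rw [map_neg, map_neg_eq_map] at this
    linarith, hg y⟩
  have hgc : Continuous g := by
    refine continuous_of_continuousAt_zero g.toAddMonoidHom ?_
    have h0 : Tendsto q (𝓝 0) (𝓝 0) := by simpa using hq.tendsto 0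
    have : Tendsto g (𝓝 0) (𝓝 0) := squeeze_zero_norm habs h0
    simpa [ContinuousAt] using this
  refine ⟨⟨g, hgc⟩, habs, ?_⟩
  have := hgx ⟨x, Submodule.mem_span_singleton_self x⟩
  rwa [LinearPMap.mkSpanSingleton_apply] at this

/-- The increments of an absolutely continuous curve, measured by a continuous seminorm, are
dominated by the increments of an indefinite Lebesgue integral. -/
theorem IsACOnIcc.exists_seminorm_increments_le {c : ℝ → E} {a b : ℝ} (h : IsACOnIcc c a b)
    {q : Seminorm ℝ E} (hq : Continuous q) : ∃ k : ℝ → ℝ, IntegrableOn k (Icc a b) ∧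
      ∀ s ∈ Icc a b, ∀ s' ∈ Icc a b, s ≤ s' → q (c s' - c s) ≤ ∫ r in s..s', k r := by
  obtain ⟨γ, hγ, hc⟩ := h
  refine ⟨fun r => q (γ r), hγ.integrableOn_seminorm hq, fun s hs s' hs' hss' => ?_⟩
  obtain ⟨l, hl, hlx⟩ := exists_clm_abs_le_seminorm hq (c s' - c s)
  have hlint : IntegrableOn (fun r => l (γ r)) (Icc a b) :=
    (hγ.integrableOn_seminorm hq).mono' (hγ.aestronglyMeasurable_comp l.continuous)
      (Eventually.of_forall fun r => hl _)
  have hii : ∀ {k : ℝ → ℝ}, IntegrableOn k (Icc a b) → ∀ x ∈ Icc a b, ∀ y ∈ Icc a b,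
      IntervalIntegrable k volume x y := by
    intro k hk x hx y hy
    refine IntegrableOn.intervalIntegrable (hk.mono_set ?_)
    exact ordConnected_Icc.uIcc_subset hx hy
  have ha : a ∈ Icc a b := left_mem_Icc.2 (hs.1.trans hs.2)
  rw [← hlx]
  have h1 : c s' - c s = (c s' - c a) - (c s - c a) := by abel
  rw [h1, map_sub, hc s' hs' l, hc s hs l, intervalIntegral.integral_interval_sub_left
    (hii hlint a ha s' hs') (hii hlint a ha s hs)]
  exact intervalIntegral.integral_mono_on hss' (hii hlint s hs s' hs')
    (hii (hγ.integrableOn_seminorm hq) s hs s' hs') fun r _ => (le_abs_self _).trans (hl _)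

variable [ContinuousSMul ℝ E] [LocallyConvexSpace ℝ E]

theorem exists_isOpen_convex_mem_subset {x : E} {S : Set E} (hS : S ∈ 𝓝 x) :
    ∃ N, IsOpen N ∧ x ∈ N ∧ Convex ℝ N ∧ N ⊆ S := by
  obtain ⟨T, ⟨hT, hc⟩, hTS⟩ := (LocallyConvexSpace.convex_basis (𝕜 := ℝ) x).mem_iff.1 hS
  exact ⟨interior T, isOpen_interior, mem_interior_iff_mem_nhds.2 hT, hc.interior,
    interior_subset.trans hTS⟩

/-- Chain rule for the composition of a `C¹`-map with a curve differentiable at a point. -/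
theorem IsC1On.tendsto_slope_comp [IsTopologicalAddGroup F] [ContinuousSMul ℝ F]
    [LocallyConvexSpace ℝ F] [T2Space F] {g : E → F} {U : Set E} (hg : IsC1On g U)
    {c : ℝ → E} {t₀ : ℝ} {L : Filter ℝ} (hU : U ∈ 𝓝 (c t₀)) {y : E} {w : F}
    (hL : L ≤ 𝓝[≠] t₀) (hc : Tendsto (slope c t₀) L (𝓝 y)) (hw : HasDirDeriv g (c t₀) y w) :
    Tendsto (slope (g ∘ c) t₀) L (𝓝 w) := by
  obtain ⟨-, dg, hdg, hgd⟩ := hg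
  have hw' : dg (c t₀, y) = w := tendsto_nhds_unique (hgd _ (mem_of_mem_nhds hU) y) hw
  have hcont : ContinuousAt dg (c t₀, y) :=
    hdg.continuousAt (prod_mem_nhds hU univ_mem)
  have hctend : Tendsto c L (𝓝 (c t₀)) := by
    have h1 : Tendsto (fun s => (s - t₀) • slope c t₀ s + c t₀) L (𝓝 ((0 : ℝ) • y + c t₀)) := by
      refine (Tendsto.smul ?_ hc).add_const _
      have : Tendsto (fun s : ℝ => s - t₀) (𝓝 t₀) (𝓝 (t₀ - t₀)) :=
        (continuous_id.sub continuous_const).tendsto _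
      rw [sub_self] at this
      exact this.mono_left (hL.trans nhdsWithin_le_nhds)
    rw [zero_smul, zero_add] at h1
    refine h1.congr fun s => ?_
    rw [sub_smul_slope]; simp
  intro A hA
  obtain ⟨C, ⟨hC, hCc, hCconv⟩, hCA⟩ : ∃ C : Set F, (C ∈ 𝓝 w ∧ IsClosed C ∧ Convex ℝ C) ∧ C ⊆ A := by
    obtain ⟨C₁, hC₁, hC₁c, hC₁A⟩ := exists_mem_nhds_isClosed_subset hA
    obtain ⟨C₂, hC₂o, hC₂w, hC₂, hC₂s⟩ := exists_isOpen_convex_mem_subset hC₁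
    exact ⟨closure C₂, ⟨mem_of_superset (hC₂o.mem_nhds hC₂w) subset_closure, isClosed_closure,
      hC₂.closure⟩, (closure_minimal hC₂s hC₁c).trans hC₁A⟩
  rw [← hw'] at hC
  obtain ⟨N₁, hN₁, N₂, hN₂, hN⟩ := mem_nhds_prod_iff.1 (hcont hC)
  obtain ⟨N, hNo, hNx, hNc, hNs⟩ := exists_isOpen_convex_mem_subset (inter_mem hN₁ hU)
  rw [mem_map]
  filter_upwards [hctend (hNo.mem_nhds hNx), hc hN₂,
    hL (self_mem_nhdsWithin : {t₀}ᶜ ∈ 𝓝[≠] t₀)] with s hs hs2 hne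
  refine hCA ?_
  -- If the slope of `g ∘ c` were outside `C`, some `l` would separate it from `C`. By the mean
  -- value theorem, `l` takes the same value on this slope as on a derivative lying in `C`.
  by_contra hnot
  obtain ⟨l, a, hla, hal⟩ := geometric_hahn_banach_closed_point hCconv hCc hnot
  have hseg : ∀ r ∈ Icc (0 : ℝ) 1, c t₀ + r • (c s - c t₀) ∈ N := fun r hr =>
    hNc.add_smul_sub_mem hNx hs hr
  have hθ : s - t₀ ≠ 0 := sub_ne_zero.2 hne
  have hsl : c s - c t₀ = (s - t₀) • slope c t₀ s := by rw [sub_smul_slope]; simp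
  have hd : ∀ r ∈ Icc (0 : ℝ) 1, HasDirDeriv g (c t₀ + r • (c s - c t₀)) (c s - c t₀)
      ((s - t₀) • dg (c t₀ + r • (c s - c t₀), slope c t₀ s)) := by
    intro r hr
    have := (hgd _ (hNs (hseg r hr)).2 (slope c t₀ s)).smul (s - t₀)
    rwa [← hsl] at this
  obtain ⟨r, hr, he⟩ := exists_dirDeriv_eq_increment
    (d := fun r => (s - t₀) • dg (c t₀ + r • (c s - c t₀), slope c t₀ s)) l hd
  have h1 : l (slope (g ∘ c) t₀ s) = l (dg (c t₀ + r • (c s - c t₀), slope c t₀ s)) := by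
    simp only [slope, vsub_eq_sub, Function.comp_apply, map_smul, map_sub, smul_eq_mul,
      add_sub_cancel] at he ⊢
    rw [← he]
    field_simp
  have h2 := hla (dg (c t₀ + r • (c s - c t₀), slope c t₀ s))
    (hN (mk_mem_prod (hNs (hseg r hr)).1 hs2))
  rw [h1] at hal
  exact lt_asymm h2 hal

theorem exists_continuous_seminorm_ball_subset {S : Set E} (hS : S ∈ 𝓝 (0 : E)) :
    ∃ q : Seminorm ℝ E, Continuous q ∧ q.ball 0 1 ⊆ S := by
  obtain ⟨s, hs, hsS⟩ := (nhds_hasBasis_absConvex_open ℝ E).mem_iff.1 hS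
  let B : AbsConvexOpenSets ℝ E := ⟨s, hs⟩
  refine ⟨gaugeSeminormFamily ℝ E B, ?_, ?_⟩
  · exact (with_gaugeSeminormFamily (𝕜 := ℝ) (E := E)).continuous_seminorm _
  · rw [gaugeSeminormFamily_ball]
    exact hsS

/-- `C¹`-maps are locally Lipschitz. -/
theorem IsC1On.exists_seminorm_lipschitz [ContinuousConstSMul ℝ F]
    {g : E → F} {U : Set E} (hg : IsC1On g U) (l : F →L[ℝ] ℝ)
    {x₀ : E} (hU : U ∈ 𝓝 x₀) : ∃ q : Seminorm ℝ E, Continuous q ∧ ∃ N, IsOpen N ∧ x₀ ∈ N ∧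
      ∀ x ∈ N, ∀ x' ∈ N, |l (g x') - l (g x)| ≤ q (x' - x) := by
  obtain ⟨-, dg, hdg, hgd⟩ := hg
  have hx₀ := mem_of_mem_nhds hU
  have h0 : l (dg (x₀, 0)) = 0 := by
    have h1 := (hgd x₀ hx₀ 0)
    have h2 : HasDirDeriv (l ∘ g) x₀ 0 (l (dg (x₀, 0))) :=
      ((l.continuous.tendsto _).comp h1).congr fun t => by simp
    refine tendsto_nhds_unique h2 ?_
    simp
  have hcont : ContinuousAt (fun p => l (dg p)) (x₀, 0) :=
    l.continuous.continuousAt.comp (hdg.continuousAt (prod_mem_nhds hU univ_mem))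
  have hm : {p : E × E | |l (dg p)| < 1} ∈ 𝓝 (x₀, (0 : E)) :=
    hcont.abs.eventually_lt continuousAt_const (by simp [h0])
  obtain ⟨N₁, hN₁, N₂, hN₂, hN⟩ := mem_nhds_prod_iff.1 hm
  obtain ⟨N, hNo, hNx, hNc, hNs⟩ := exists_isOpen_convex_mem_subset (inter_mem hN₁ hU)
  obtain ⟨q, hq, hqN⟩ := exists_continuous_seminorm_ball_subset hN₂
  refine ⟨q, hq, N, hNo, hNx, fun x hx x' hx' => ?_⟩
  obtain ⟨r, hr, he⟩ := exists_dirDeriv_eq_increment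
    (d := fun r => dg (x + r • (x' - x), x' - x)) (x := x) (y := x' - x) l
    fun r hr => hgd _ (hNs (hNc.add_smul_sub_mem hx hx' hr)).2 _
  rw [add_sub_cancel] at he
  rw [← he]
  -- Since `q (x' - x)` may be zero, the direction is rescaled by an arbitrary `c` above it.
  refine le_of_forall_gt_imp_ge_of_dense fun c hc => ?_
  have hc0 : 0 < c := (apply_nonneg q _).trans_lt hc
  have hz := hNs (hNc.add_smul_sub_mem hx hx' hr)
  have hball : c⁻¹ • (x' - x) ∈ q.ball 0 1 := by
    rw [Seminorm.mem_ball_zero, map_smul_eq_mul, Real.norm_eq_abs, abs_of_pos (inv_pos.2 hc0),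
      inv_mul_lt_one₀ hc0]
    exact hc
  have hlt : |l (dg (x + r • (x' - x), c⁻¹ • (x' - x)))| < 1 := hN ⟨hz.1, hqN hball⟩
  -- Homogeneity is checked after applying `l`, where limits are unique; `F` is not assumed
  -- Hausdorff.
  have hsm : l (dg (x + r • (x' - x), c⁻¹ • (x' - x)))
      = c⁻¹ * l (dg (x + r • (x' - x), x' - x)) := by
    have h1 : HasDirDeriv (l ∘ g) (x + r • (x' - x)) (c⁻¹ • (x' - x)) _ :=
      ((l.continuous.tendsto _).comp (hgd _ hz.2 (c⁻¹ • (x' - x)))).congr fun t => by simp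
    have h2 : HasDirDeriv (l ∘ g) (x + r • (x' - x)) (x' - x) _ :=
      ((l.continuous.tendsto _).comp (hgd _ hz.2 (x' - x))).congr fun t => by simp
    exact tendsto_nhds_unique h1 (h2.smul c⁻¹)
  rw [hsm, abs_mul, abs_of_pos (inv_pos.2 hc0), inv_mul_lt_one₀ hc0] at hlt
  exact hlt.le

end Calculus

attribute [instance] FrechetSpace.isUniformAddGroup FrechetSpace.continuousSMul
  FrechetSpace.locallyConvexSpace FrechetSpace.t2Space

/-! ### Velocities and Lipschitz estimates in charts -/

section Manifolds

variable {E : Type*} [AddCommGroup E] [Module ℝ E] [UniformSpace E] [FrechetSpace E]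
  {M : Type*} [TopologicalSpace M] [chartsM : ChartedSpace E M]

/-- The velocity of a curve can be computed in every chart. -/
theorem HasVelocityAt.hasCurveDeriv [IsC1Manifold E M] {η : ℝ → M} {I : Set ℝ} {t : ℝ}
    {x : TangentVector E (η t)} (h : HasVelocityAt η I t x) (hη : ContinuousWithinAt η I t)
    (φ : ChartsAt E (η t)) : HasCurveDeriv (φ.1 ∘ η) I t (x.coord φ) := by
  obtain ⟨e, he⟩ := h
  have hsrc : ∀ᶠ s in 𝓝[I \ {t}] t, η s ∈ e.1.source :=
    (hη.mono sdiff_subset).eventually (e.1.open_source.mem_nhds e.2.2)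
  have hle : 𝓝[I \ {t}] t ≤ 𝓝[(I ∩ η ⁻¹' e.1.source) \ {t}] t := by
    refine nhdsWithin_le_iff.2 ?_
    filter_upwards [hsrc, self_mem_nhdsWithin] with s hs hs' using ⟨⟨hs'.1, hs⟩, hs'.2⟩
  have hC1 := IsC1Manifold.compatible e.1 e.2.1 φ.1 φ.2.1
  have hU : (e.1.symm.trans φ.1).source ∈ 𝓝 ((e.1 ∘ η) t) := by
    refine (e.1.symm.trans φ.1).open_source.mem_nhds ?_
    simp [e.2.2, φ.2.2]
  have hne : 𝓝[I \ {t}] t ≤ 𝓝[≠] t := nhdsWithin_mono _ fun s hs => hs.2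
  refine (hC1.tendsto_slope_comp hU hne (he.mono_left hle) (x.compatible e φ)).congr' ?_
  filter_upwards [hsrc] with s hs
  simp [slope, hs, e.2.2]

variable {E₁ N₁ E₂ N₂ : Type*}
  [AddCommGroup E₁] [Module ℝ E₁] [UniformSpace E₁] [FrechetSpace E₁]
  [TopologicalSpace N₁] [charts₁ : ChartedSpace E₁ N₁]
  [AddCommGroup E₂] [Module ℝ E₂] [UniformSpace E₂] [FrechetSpace E₂]
  [TopologicalSpace N₂] [charts₂ : ChartedSpace E₂ N₂]

/-- In charts, a `C¹`-map on a product of three manifolds is locally Lipschitz in the last two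
arguments. -/
theorem IsC1MapOn.exists_seminorm_lipschitz {Ψ : N₁ × N₂ × M → M} {V : Set M} (hV : IsOpen V)
    (hΨ : IsC1MapOn (prodCharts charts₁ (prodCharts charts₂ chartsM)) chartsM Ψ
      (univ ×ˢ univ ×ˢ V)) (n₁ : N₁) {e₂ : OpenPartialHomeomorph N₂ E₂} (he₂ : e₂ ∈ atlas E₂ N₂)
    {φ e : OpenPartialHomeomorph M E} (hφ : φ ∈ atlas E M) (he : e ∈ atlas E M)
    {n₂ : N₂} (hn₂ : n₂ ∈ e₂.source) {y : M} (hy : y ∈ φ.source) (hyV : y ∈ V)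
    (hΨe : Ψ (n₁, n₂, y) ∈ e.source) (l : E →L[ℝ] ℝ) :
    ∃ (q₂ : Seminorm ℝ E₂) (q : Seminorm ℝ E), Continuous q₂ ∧ Continuous q ∧
      ∃ N : Set (E₂ × E), IsOpen N ∧ (e₂ n₂, φ y) ∈ N ∧
      ∀ m ∈ e₂.source, ∀ m' ∈ e₂.source, ∀ z ∈ φ.source, ∀ z' ∈ φ.source,
        (e₂ m, φ z) ∈ N → (e₂ m', φ z') ∈ N →
        |l (e (Ψ (n₁, m', z'))) - l (e (Ψ (n₁, m, z)))| ≤ q₂ (e₂ m' - e₂ m) + q (φ z' - φ z) := by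
  obtain ⟨hcont, hC1⟩ := hΨ
  set e₁ := chartAt E₁ n₁
  have hn₁ : n₁ ∈ e₁.source := mem_chart_source E₁ n₁
  let ε : OpenPartialHomeomorph (N₁ × N₂ × M) (E₁ × E₂ × E) := e₁.prod (e₂.prod φ)
  have hε : ε ∈ (prodCharts charts₁ (prodCharts charts₂ chartsM)).atlas :=
    mem_image2_of_mem (chart_mem_atlas E₁ n₁) (mem_image2_of_mem he₂ hφ)
  have hS : IsOpen ((univ ×ˢ univ ×ˢ V : Set (N₁ × N₂ × M))) :=
    isOpen_univ.prod (isOpen_univ.prod hV)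
  have hU : IsOpen (ε.target ∩ ε.symm ⁻¹' ((univ ×ˢ univ ×ˢ V) ∩ Ψ ⁻¹' e.source)) :=
    ε.isOpen_inter_preimage_symm (hcont.isOpen_inter_preimage hS e.open_source)
  have hp : (n₁, n₂, y) ∈ ε.source := ⟨hn₁, hn₂, hy⟩
  have hmem : ε (n₁, n₂, y) ∈ ε.target ∩ ε.symm ⁻¹' ((univ ×ˢ univ ×ˢ V) ∩ Ψ ⁻¹' e.source) := by
    refine ⟨ε.map_source hp, ?_⟩
    rw [mem_preimage, ε.left_inv hp]
    exact ⟨⟨mem_univ _, mem_univ _, hyV⟩, hΨe⟩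
  obtain ⟨q, hq, N, hNo, hN, hlip⟩ :=
    (hC1 ε hε e he).exists_seminorm_lipschitz l (hU.mem_nhds hmem)
  -- The restrictions of `q` to the factors `E₂` and `E`; the `E₁`-component of the increment is
  -- zero because `n₁` is fixed.
  refine ⟨q.comp ((LinearMap.inr ℝ E₁ (E₂ × E)).comp (LinearMap.inl ℝ E₂ E)),
    q.comp ((LinearMap.inr ℝ E₁ (E₂ × E)).comp (LinearMap.inr ℝ E₂ E)), ?_, ?_,
    (fun p : E₂ × E => (e₁ n₁, p)) ⁻¹' N, hNo.preimage (by fun_prop), hN, ?_⟩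
  · exact hq.comp (f := fun y : E₂ => ((0 : E₁), y, (0 : E))) (by fun_prop)
  · exact hq.comp (f := fun y : E => ((0 : E₁), (0 : E₂), y)) (by fun_prop)
  · intro m hm m' hm' z hz z' hz' hN hN'
    have h1 := hlip _ hN _ hN'
    have hs : ∀ {m z}, m ∈ e₂.source → z ∈ φ.source →
        ε.symm (e₁ n₁, e₂ m, φ z) = (n₁, m, z) := fun {m z} hm hz =>
      ε.left_inv (x := (n₁, m, z)) ⟨hn₁, hm, hz⟩
    simp only [Function.comp_apply, hs hm hz, hs hm' hz'] at h1
    refine h1.trans ?_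
    have h2 : ((e₁ n₁, e₂ m', φ z') - (e₁ n₁, e₂ m, φ z) : E₁ × E₂ × E) =
      (0, e₂ m' - e₂ m, 0) + (0, 0, φ z' - φ z) := by simp
    rw [h2]
    exact map_add_le_add q _ _

end Manifolds

/-! ### Transporting a solution back to its initial time -/

section Flows

variable {E : Type*} [AddCommGroup E] [Module ℝ E] [UniformSpace E] [FrechetSpace E]
  {M : Type*} [TopologicalSpace M] [chartsM : ChartedSpace E M] [IsC1Manifold E M]
  {W : Set (ℝ × M)}

/-- Two curves through the same point whose velocities there are given by the same vector field
are tangent to each other in every chart. -/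
theorem tendsto_slope_sub_slope_of_hasVelocityAt {f : (p : W) → TangentVector E p.1.2}
    {η₁ η₂ : ℝ → M} {I₁ I₂ K : Set ℝ} {t : ℝ} (h₁ : (t, η₁ t) ∈ W) (h₂ : (t, η₂ t) ∈ W)
    (hv₁ : HasVelocityAt η₁ I₁ t (f ⟨(t, η₁ t), h₁⟩))
    (hv₂ : HasVelocityAt η₂ I₂ t (f ⟨(t, η₂ t), h₂⟩))
    (hc₁ : ContinuousWithinAt η₁ I₁ t) (hc₂ : ContinuousWithinAt η₂ I₂ t)
    (hK₁ : K ⊆ I₁) (hK₂ : K ⊆ I₂) (heq : η₁ t = η₂ t)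
    {φ : OpenPartialHomeomorph M E} (hφ : φ ∈ atlas E M) (ht : η₁ t ∈ φ.source) :
    Tendsto (fun s => slope (φ ∘ η₁) t s - slope (φ ∘ η₂) t s) (𝓝[K \ {t}] t) (𝓝 0) := by
  have hd₁ := hv₁.hasCurveDeriv hc₁ ⟨φ, hφ, ht⟩
  have hd₂ := hv₂.hasCurveDeriv hc₂ ⟨φ, hφ, heq ▸ ht⟩
  -- The two values of `f` lie in tangent spaces at points that are only propositionally equal, so
  -- their coordinates in `φ` are compared.
  have hcoord : ∀ (y z : M) (hyz : y = z) (hy : (t, y) ∈ W) (hz : (t, z) ∈ W)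
      (hy' : y ∈ φ.source) (hz' : z ∈ φ.source),
      (f ⟨(t, y), hy⟩).coord ⟨φ, hφ, hy'⟩ = (f ⟨(t, z), hz⟩).coord ⟨φ, hφ, hz'⟩ := by
    rintro y z rfl _ _ _ _
    rfl
  rw [hcoord _ _ heq h₁ h₂ ht (heq ▸ ht)] at hd₁
  have h := (hd₁.mono_left (nhdsWithin_mono t (sdiff_subset_sdiff_left hK₁))).sub
    (hd₂.mono_left (nhdsWithin_mono t (sdiff_subset_sdiff_left hK₂)))
  rwa [sub_self] at h

variable {E₁ N₁ E₂ N₂ : Type*}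
  [AddCommGroup E₁] [Module ℝ E₁] [UniformSpace E₁] [FrechetSpace E₁]
  [TopologicalSpace N₁] [charts₁ : ChartedSpace E₁ N₁]
  [AddCommGroup E₂] [Module ℝ E₂] [UniformSpace E₂] [FrechetSpace E₂]
  [TopologicalSpace N₂] [charts₂ : ChartedSpace E₂ N₂]

/-- Near the initial time, a Carathéodory solution is transported to its initial value by a local
flow which is the pullback of a `C¹`-map. -/
theorem IsCaratheodorySolution.eventually_flow_eq {f : (p : W) → TangentVector E p.1.2}
    {I₁ : Set ℝ} {γ : ℝ → M} (hγ : IsCaratheodorySolution f I₁ γ)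
    {I : Set ℝ} {V Y : Set M} {Φ : ℝ → ℝ → M → M} (hV : IsOpen V)
    (hΦ : ∀ t₀ ∈ I, ∀ y₀ ∈ V, IsIVPSolution f t₀ y₀ I (fun t => Φ t t₀ y₀))
    (hY : IsOpen Y) (hYV : Y ⊆ V) (hΦY : ∀ t₀ ∈ I, ∀ t₁ ∈ I, MapsTo (Φ t₁ t₀) Y V)
    (hflow : ∀ t₀ ∈ I, ∀ t₁ ∈ I, ∀ t₂ ∈ I, ∀ y₀ ∈ Y, Φ t₂ t₁ (Φ t₁ t₀ y₀) = Φ t₂ t₀ y₀)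
    {ζ₁ : ℝ → N₁} {ζ₂ : ℝ → N₂} {Ψ : N₁ × N₂ × M → M} (hζ₂ : IsACCurve E₂ ζ₂ I)
    (hΨ : IsC1MapOn (prodCharts charts₁ (prodCharts charts₂ chartsM)) chartsM Ψ
      (univ ×ˢ univ ×ˢ V))
    (hΦΨ : ∀ t ∈ I, ∀ t₀ ∈ I, ∀ y₀ ∈ V, Φ t t₀ y₀ = Ψ (ζ₁ t, ζ₂ t₀, y₀))
    {I₀ : Set ℝ} (hI₀ : volume (I \ I₀) = 0)
    (hvel : ∀ y₀ ∈ V, ∀ t₀ ∈ I, ∀ t ∈ I₀, ∃ h : (t, Φ t t₀ y₀) ∈ W,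
      HasVelocityAt (fun s => Φ s t₀ y₀) I t (f ⟨(t, Φ t t₀ y₀), h⟩))
    {t₀ : ℝ} (ht₀ : t₀ ∈ I₁) (hI : I ∈ 𝓝[I₁] t₀) (hγt₀ : γ t₀ ∈ Y) :
    ∀ᶠ t in 𝓝[I₁] t₀, Φ t₀ t (γ t) = γ t₀ := by
  have ht₀I : t₀ ∈ I := mem_of_mem_nhdsWithin ht₀ hI
  have hΦid : ∀ t ∈ I, ∀ y ∈ V, Φ t t y = y := fun t ht y hy => (hΦ t ht y hy).2.2
  have hγc := hγ.absCont.1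
  obtain ⟨φ, hφ, α, β, hαβ, hαβI, hαβn, hαβφ, hγac⟩ := hγ.absCont.2 t₀ ht₀
  obtain ⟨e₂, he₂, a, b, hab, habI, habn, habe, hζac⟩ := hζ₂.2 t₀ ht₀I
  set e := chartAt E (γ t₀)
  have he : e ∈ atlas E M := chart_mem_atlas E _
  have habn' : Icc a b ∈ 𝓝[I₁] t₀ :=
    nhdsWithin_le_of_mem hI habn
  have hηe : ∀ᶠ t in 𝓝[I₁] t₀, Ψ (ζ₁ t₀, ζ₂ t, γ t) ∈ e.source := by
    have h1 : Tendsto (fun t => (ζ₁ t₀, ζ₂ t, γ t)) (𝓝[I₁] t₀) (𝓝 (ζ₁ t₀, ζ₂ t₀, γ t₀)) :=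
      tendsto_const_nhds.prodMk_nhds (((hζ₂.1 t₀ ht₀I).mono_left
        (nhdsWithin_le_of_mem hI)).prodMk_nhds (hγc t₀ ht₀))
    have hS : (univ ×ˢ univ ×ˢ V : Set (N₁ × N₂ × M)) ∈ 𝓝 (ζ₁ t₀, ζ₂ t₀, γ t₀) :=
      (isOpen_univ.prod (isOpen_univ.prod hV)).mem_nhds ⟨mem_univ _, mem_univ _, hYV hγt₀⟩
    have h2 := (hΨ.1.continuousAt hS).tendsto.comp h1
    refine h2 (e.open_source.mem_nhds ?_)
    rw [← hΦΨ t₀ ht₀I t₀ ht₀I _ (hYV hγt₀), hΦid t₀ ht₀I _ (hYV hγt₀)]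
    exact mem_chart_source E _
  have hγY : ∀ᶠ t in 𝓝[I₁] t₀, γ t ∈ Y := (hγc t₀ ht₀) (hY.mem_nhds hγt₀)
  obtain ⟨ε, hε, hball⟩ := Metric.mem_nhdsWithin_iff.1
    (inter_mem (inter_mem hαβn habn') (inter_mem (inter_mem hI self_mem_nhdsWithin)
      (hηe.and hγY)))
  -- An interval around `t₀` on which the three charts are usable and `γ` stays in `Y`.
  set K := Metric.ball t₀ ε ∩ I₁
  have hKn : K ∈ 𝓝[I₁] t₀ := inter_mem (mem_nhdsWithin_of_mem_nhds (Metric.ball_mem_nhds t₀ hε))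
    self_mem_nhdsWithin
  have hKoc : K.OrdConnected := (convex_ball t₀ ε).ordConnected.inter hγ.interval.1
  have hKm : MeasurableSet K := hKoc.measurableSet
  have ht₀K : t₀ ∈ K := ⟨Metric.mem_ball_self hε, ht₀⟩
  have hKαβ : K ⊆ Icc α β := fun t ht => (hball ht).1.1
  have hKab : K ⊆ Icc a b := fun t ht => (hball ht).1.2
  have hKI : K ⊆ I := fun t ht => (hball ht).2.1.1
  have hKI₁ : K ⊆ I₁ := inter_subset_right
  have hKe : ∀ t ∈ K, Ψ (ζ₁ t₀, ζ₂ t, γ t) ∈ e.source := fun t ht => (hball ht).2.2.1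
  have hKY : ∀ t ∈ K, γ t ∈ Y := fun t ht => (hball ht).2.2.2
  have hKφ : ∀ t ∈ K, γ t ∈ φ.source := fun t ht => hαβφ (hKαβ ht)
  have hKe₂ : ∀ t ∈ K, ζ₂ t ∈ e₂.source := fun t ht => habe (hKab ht)
  have hcζ : ∀ t ∈ K, Tendsto (fun s => e₂ (ζ₂ s)) (𝓝[K] t) (𝓝 (e₂ (ζ₂ t))) := fun t ht =>
    (e₂.continuousAt (hKe₂ t ht)).tendsto.comp ((hζ₂.1 t (hKI ht)).mono hKI)
  have hcγ : ∀ t ∈ K, Tendsto (fun s => φ (γ s)) (𝓝[K] t) (𝓝 (φ (γ t))) := fun t ht =>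
    (φ.continuousAt (hKφ t ht)).tendsto.comp ((hγc t (hKI₁ ht)).mono hKI₁)
  have hlip := fun (l : E →L[ℝ] ℝ) t (ht : t ∈ K) =>
    hΨ.exists_seminorm_lipschitz hV (ζ₁ t₀) he₂ hφ he (hKe₂ t ht) (hKφ t ht)
      (hYV (hKY t ht)) (hKe t ht) l
  have hconst : ∀ l : E →L[ℝ] ℝ, ∀ t ∈ K,
      l (e (Ψ (ζ₁ t₀, ζ₂ t, γ t))) = l (e (Ψ (ζ₁ t₀, ζ₂ t₀, γ t₀))) := by
    intro l t ht
    refine eq_of_increments_le_integral_of_ae_slope_tendsto_zero hKoc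
      (u := fun t => l (e (Ψ (ζ₁ t₀, ζ₂ t, γ t)))) ?_ ?_ ht ht₀K
    · have hae : ∀ᵐ t ∂volume.restrict K, t ∈ I₀ := by
        rw [ae_restrict_iff' hKm]
        filter_upwards [measure_eq_zero_iff_ae_notMem.1 hI₀] with t ht htK
        by_contra h
        exact ht ⟨hKI htK, h⟩
      filter_upwards [hae, ae_restrict_of_ae_restrict_of_subset hKI₁ hγ.velocity,
        ae_restrict_mem hKm] with t htI₀ htv htK
      obtain ⟨hW₁, hv₁⟩ := htv
      have htI := hKI htK
      have htV := hYV (hKY t htK)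
      -- The null set `I \ I₀` serves all initial data at once, so `(t, γ t)` itself may be the
      -- initial condition although it varies with `t`.
      obtain ⟨hW₂, hv₂⟩ := hvel (γ t) htV t htI t htI₀
      have hid := hΦid t htI _ htV
      have hcδ : ContinuousWithinAt (fun s => Φ s t (γ t)) I t :=
        (hΦ t htI _ htV).1.absCont.1 t htI
      obtain ⟨q₂, q, -, hq, N, hNo, hN, hqN⟩ := hlip l t htK
      have htend := tendsto_slope_sub_slope_of_hasVelocityAt hW₁ hW₂ hv₁ hv₂
        (hγc t (hKI₁ htK)) hcδ hKI₁ hKI hid.symm hφ (hKφ t htK)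
      have hq0 := (hq.tendsto 0).comp htend
      rw [map_zero] at hq0
      refine squeeze_zero_norm' ?_ hq0
      have hKle : 𝓝[K \ {t}] t ≤ 𝓝[K] t := nhdsWithin_mono _ sdiff_subset
      have hδt : Tendsto (fun s => Φ s t (γ t)) (𝓝[K \ {t}] t) (𝓝 (γ t)) := by
        have := hcδ.mono (sdiff_subset.trans hKI : K \ {t} ⊆ I)
        rw [ContinuousWithinAt, hid] at this
        exact this
      have hev₁ : ∀ᶠ s in 𝓝[K \ {t}] t, (e₂ (ζ₂ s), φ (γ s)) ∈ N :=
        (((hcζ t htK).prodMk_nhds (hcγ t htK)).mono_left hKle) (hNo.mem_nhds hN)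
      have hev₂ : ∀ᶠ s in 𝓝[K \ {t}] t, (e₂ (ζ₂ s), φ (Φ s t (γ t))) ∈ N :=
        (((hcζ t htK).mono_left hKle).prodMk_nhds
          ((φ.continuousAt (hKφ t htK)).tendsto.comp hδt)) (hNo.mem_nhds hN)
      have hev₃ : ∀ᶠ s in 𝓝[K \ {t}] t, Φ s t (γ t) ∈ φ.source :=
        hδt (φ.open_source.mem_nhds (hKφ t htK))
      filter_upwards [hev₁, hev₂, hev₃, self_mem_nhdsWithin] with s hs₁ hs₂ hs₃ hsK
      -- Both points have the same second argument `ζ₂ s`, so the `q₂` term vanishes and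
      -- differentiability of `ζ₂` plays no role.
      have hmain := hqN _ (hKe₂ s hsK.1) _ (hKe₂ s hsK.1) _ hs₃ _ (hKφ s hsK.1) hs₂ hs₁
      rw [sub_self, map_zero, zero_add] at hmain
      -- By the flow property, the comparison curve carried back to time `t₀` is constant in `s`;
      -- hence `hmain` bounds the increment of `u` from `t` to `s`.
      have hback : Ψ (ζ₁ t₀, ζ₂ s, Φ s t (γ t)) = Ψ (ζ₁ t₀, ζ₂ t, γ t) := by
        rw [← hΦΨ t₀ ht₀I s (hKI hsK.1) _ (hΦY t htI s (hKI hsK.1) (hKY t htK)),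
          hflow t htI s (hKI hsK.1) t₀ ht₀I _ (hKY t htK), hΦΨ t₀ ht₀I t htI _ htV]
      rw [hback] at hmain
      have hsl : slope (φ ∘ γ) t s - slope (φ ∘ fun s => Φ s t (γ t)) t s =
          (s - t)⁻¹ • (φ (γ s) - φ (Φ s t (γ t))) := by
        simp only [slope, vsub_eq_sub, Function.comp_apply, ← smul_sub, hid]
        congr 1
        abel
      rw [Function.comp_apply, hsl, map_smul_eq_mul, slope, vsub_eq_sub, norm_smul]
      exact mul_le_mul_of_nonneg_left hmain (norm_nonneg _)
    · intro t htK
      obtain ⟨q₂, q, hq₂, hq, N, hNo, hN, hqN⟩ := hlip l t htK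
      obtain ⟨k₂, hk₂, hk₂'⟩ := hζac.exists_seminorm_increments_le hq₂
      obtain ⟨k, hk, hk'⟩ := hγac.exists_seminorm_increments_le hq
      have hk₂K := hk₂.mono_set hKab
      have hkK := hk.mono_set hKαβ
      -- The dominating density adds the contributions of `ζ₂` and `γ`, both absolutely continuous
      -- in their charts.
      refine ⟨fun r => k₂ r + k r, hk₂K.add hkK, {s | (e₂ (ζ₂ s), φ (γ s)) ∈ N} ∩ K,
        inter_mem (((hcζ t htK).prodMk_nhds (hcγ t htK)) (hNo.mem_nhds hN))
          self_mem_nhdsWithin, fun s hs s' hs' hss' => ?_⟩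
      have hsub := hKoc.uIcc_subset hs.2 hs'.2
      rw [intervalIntegral.integral_add (hk₂K.mono_set hsub).intervalIntegrable
        (hkK.mono_set hsub).intervalIntegrable]
      exact (hqN _ (hKe₂ s hs.2) _ (hKe₂ s' hs'.2) _ (hKφ s hs.2) _ (hKφ s' hs'.2) hs.1 hs'.1).trans
        (add_le_add (hk₂' s (hKab hs.2) s' (hKab hs'.2) hss')
          (hk' s (hKαβ hs.2) s' (hKαβ hs'.2) hss'))
  filter_upwards [hKn] with t ht
  -- Continuous linear functionals separate the points of `E`.
  have heq : e (Ψ (ζ₁ t₀, ζ₂ t, γ t)) = e (Ψ (ζ₁ t₀, ζ₂ t₀, γ t₀)) := by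
    by_contra hne
    obtain ⟨l, hl⟩ := geometric_hahn_banach_point_point hne
    exact hl.ne (hconst l t ht)
  have hΨeq := e.injOn (hKe t ht) (hKe t₀ ht₀K) heq
  rw [hΦΨ t₀ ht₀I t (hKI ht) _ (hYV (hKY t ht)), hΨeq,
    ← hΦΨ t₀ ht₀I t₀ ht₀I _ (hYV hγt₀), hΦid t₀ ht₀I _ (hYV hγt₀)]

end Flows

/-! ### Local existence and local uniqueness -/

section Equation

variable {E : Type u} [AddCommGroup E] [Module ℝ E] [UniformSpace E]
  {M : Type w} [TopologicalSpace M] [ChartedSpace E M] {W : Set (ℝ × M)}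

theorem AdmitsLocalFlows.localExistence {J : Set ℝ} {f : (p : W) → TangentVector E p.1.2}
    (hf : AdmitsLocalFlows.{v, u, w} J f) : LocalExistence J f := by
  intro t₀ y₀ h
  obtain ⟨I, V, Φ, -, hIJ, ht₀, -, hy₀, -, hΦ, -⟩ := hf t₀ y₀ h
  exact ⟨I, fun t => Φ t t₀ y₀, hIJ, hΦ t₀ ht₀ y₀ hy₀⟩

theorem AdmitsLocalFlows.localUniqueness [FrechetSpace E] [IsC1Manifold E M] {J : Set ℝ}
    (hW : W ⊆ J ×ˢ univ) {f : (p : W) → TangentVector E p.1.2}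
    (hf : AdmitsLocalFlows.{v, u, w} J f) : LocalUniqueness f := by
  -- The curve `η` is chosen before the solution, so any two solutions with these initial data agree
  -- with the same `η` near `t₀`.
  have key : ∀ t₀ y₀, (t₀, y₀) ∈ W → ∃ η : ℝ → M, ∀ (I₁ : Set ℝ) (γ : ℝ → M),
      IsCaratheodorySolution f I₁ γ → t₀ ∈ I₁ → γ t₀ = y₀ → ∀ᶠ t in 𝓝[I₁] t₀, γ t = η t := by
    intro t₀ y₀ h
    obtain ⟨I, V, Φ, -, ⟨O, hO, rfl⟩, ht₀I, hV, hy₀V, -, hΦ, ⟨Y, hY, hy₀Y, hYV, hΦY, hflow⟩,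
      ⟨E₁, _, _, _, _, E₂, _, _, _, _, N₁, _, _, _, N₂, _, _, _, ζ₁, ζ₂, Ψ, -, hζ₂, hΨ, hΦΨ⟩,
      ⟨I₀, -, -, hI₀, hvel⟩⟩ := hf t₀ y₀ h
    refine ⟨fun t => Φ t t₀ y₀, fun I₁ γ hγ ht₀ hγt₀ => ?_⟩
    subst hγt₀
    -- The domain `I₁` lies in `J`, because the graph of `γ` lies in `W`.
    have hI : O ∩ J ∈ 𝓝[I₁] t₀ := by
      filter_upwards [mem_nhdsWithin_of_mem_nhds (hO.mem_nhds ht₀I.1), self_mem_nhdsWithin]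
        with t ht ht' using ⟨ht, (hW (hγ.mem t ht')).1⟩
    filter_upwards [hγ.eventually_flow_eq hV hΦ hY hYV hΦY hflow hζ₂ hΨ hΦΨ hI₀ hvel ht₀ hI hy₀Y,
      hI, (hγ.absCont.1 t₀ ht₀) (hY.mem_nhds hy₀Y)] with t ht htI htY
    calc γ t = Φ t t (γ t) := ((hΦ t htI _ (hYV htY)).2.2).symm
      _ = Φ t t₀ (Φ t₀ t (γ t)) := (hflow t htI t₀ ht₀I t htI _ htY).symm
      _ = Φ t t₀ (γ t₀) := by rw [ht]
  intro I₁ I₂ γ₁ γ₂ h₁ h₂ t₀ ht₀ heq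
  obtain ⟨η, hη⟩ := key t₀ (γ₁ t₀) (h₁.mem t₀ ht₀.1)
  have hev : ∀ᶠ t in 𝓝[I₁ ∩ I₂] t₀, γ₁ t = γ₂ t := by
    filter_upwards [nhdsWithin_mono t₀ inter_subset_left (hη I₁ γ₁ h₁ ht₀.1 rfl),
      nhdsWithin_mono t₀ inter_subset_right (hη I₂ γ₂ h₂ ht₀.2 heq.symm)] with t ht ht'
      using ht.trans ht'.symm
  obtain ⟨ε, hε, hball⟩ := Metric.mem_nhdsWithin_iff.1 hev
  exact ⟨Metric.ball t₀ ε ∩ (I₁ ∩ I₂),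
    (convex_ball t₀ ε).ordConnected.inter (h₁.interval.1.inter h₂.interval.1),
    ⟨Metric.ball t₀ ε, Metric.isOpen_ball, rfl⟩, ⟨Metric.mem_ball_self hε, ht₀⟩,
    fun t ht => hball ht⟩

end Equation

end CaratheodoryFlow

theorem proposition1p1
    {E : Type u} [AddCommGroup E] [Module ℝ E] [UniformSpace E] [CaratheodoryFlow.FrechetSpace E]
    {M : Type w} [TopologicalSpace M] [ChartedSpace E M] [CaratheodoryFlow.IsC1Manifold E M]
    (J : Set ℝ) (hJ : CaratheodoryFlow.IsNondegInterval J)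
    (W : Set (ℝ × M)) (hW : CaratheodoryFlow.IsRelOpen W (J ×ˢ (univ : Set M)))
    (f : (p : W) → CaratheodoryFlow.TangentVector E p.1.2)
    (hf : CaratheodoryFlow.AdmitsLocalFlows.{v, u, w} J f) :
    CaratheodoryFlow.LocalExistence J f ∧ CaratheodoryFlow.LocalUniqueness f := by
  obtain ⟨O, -, rfl⟩ := hW
  exact ⟨hf.localExistence, hf.localUniqueness inter_subset_right⟩
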